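/- For a finite lattice $D$ let $J(D)$ be the set of its nonzero join-irreducible elements and put $J^+(D)=J(D)\cup\{0,1\}$. An algebra is a nonempty, possibly infinite, set with an arbitrary family of finitary operations; $\operatorname{Con}(A)$ denotes the lattice of congruences of an algebra $A$, and $\operatorname{Princ}(A)$ the set of its principal congruences, i.e. those generated by a single pair of elements of $A$. For $Q\subseteq D$, the algebra $A$ \emph{represents} the inclusion $Q\subseteq D$ by principal congruences if there is a lattice isomorphism $\varphi\colon\operatorname{Con}(A)\to D$ with $Q=\varphi(\operatorname{Princ}(A))$. A finite lattice is \emph{planar} if it has a Hasse diagram in the plane (larger elements placed higher, coverings drawn as straight line segments) whose edges meet only at common endpoints. An element is \emph{join-reducible} if it is the join of two strictly smaller elements; a coatom is a maximal element of $D\setminus\{1\}$. \textbf{Theorem.} Let $D$ be a finite (nonempty) distributive lattice, and consider the following conditions on $D$. \begin{enumerate} \item[(i)] For every $Q$ with $J^+(D)\subseteq Q\subseteq D$, the inclusion $Q\subseteq D$ is represented by the principal congruences of some algebra $A$ (depending on $Q$). \item[(ii)] For every $Q$ with $J^+(D)\subseteq Q\subseteq D$, the inclusion $Q\subseteq D$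 is represented by the principal congruences of some finite lattice $L$ (depending on $Q$), regarded as an algebra $(L,\vee,\wedge)$. \item[(iii)] $D$ is planar and has at most one join-reducible coatom. \end{enumerate} Then (i) implies (iii), and (ii) implies (i). -/

import Mathlib

universe u v w k

namespace PrincRep

section Algebras

variable (L : FirstOrder.Language.{w, 0}) (A : Type v) [L.Structure A]

/-- An equivalence relation on `A` that is compatible with all basic operations of `A`. -/
def IsCongruence (s : Setoid A) : Prop :=
  ∀ (n : ℕ) (f : L.Functions n) (x y : Fin n → A),
    (∀ i, s (x i) (y i)) →
      s (FirstOrder.Language.Structure.funMap f x)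
        (FirstOrder.Language.Structure.funMap f y)

/-- `Con(A)`, the congruences of the algebra `A`, ordered by inclusion. -/
abbrev Congr : Type v := {s : Setoid A // IsCongruence L A s}

variable {A}

/-- `con(a, b)`, the smallest congruence of `A` that contains the pair `(a, b)`. -/
def con (a b : A) : Congr L A :=
  ⟨sInf {s : Setoid A | IsCongruence L A s ∧ s a b},
    fun n f x y h s hs => hs.1 n f x y fun i => h i s hs⟩

variable (A)

/-- `Princ(A)`, the set of principal congruences of `A`. -/
def Princ : Set (Congr L A) := {θ | ∃ a b : A, θ = con L a b}

/-- The algebra `A` represents the inclusion `Q ⊆ D` by principal congruences. -/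
def Represents {D : Type u} [Lattice D] (Q : Set D) : Prop :=
  ∃ φ : Congr L A ≃o D, Q = φ '' Princ L A

end Algebras

/-- The two binary operation symbols of lattices. -/
inductive LatticeOp : ℕ → Type
  | join : LatticeOp 2
  | meet : LatticeOp 2

/-- The signature of lattices, considered as algebras `(K, ∨, ∧)`. -/
def latticeLanguage : FirstOrder.Language.{0, 0} := ⟨LatticeOp, fun _ => Empty⟩

/-- A lattice, considered as an algebra `(K, ∨, ∧)`. -/
instance latticeStructure (K : Type v) [Lattice K] : latticeLanguage.Structure K where
  funMap := fun {_} f =>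
    match f with
    | LatticeOp.join => fun x => x 0 ⊔ x 1
    | LatticeOp.meet => fun x => x 0 ⊓ x 1
  RelMap := fun {_} r => r.elim

section Lattices

variable (D : Type u) [Lattice D]

/-- `J⁺(D)`: the (nonzero) join-irreducible elements together with `0` and `1`. -/
def JPlus [BoundedOrder D] : Set D := {x | SupIrred x} ∪ {⊥, ⊤}

/-- Every `Q` with `J⁺(D) ⊆ Q ⊆ D` is represented by the principal congruences of some
(nonempty, possibly infinite) algebra; the algebra and its signature may depend on `Q`. -/
def FullyAlgebraRepresentable [BoundedOrder D] : Prop :=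
  ∀ Q : Set D, JPlus D ⊆ Q →
    ∃ (L : FirstOrder.Language.{w, 0}) (_ : L.IsAlgebraic) (A : Type v) (_ : Nonempty A)
      (_ : L.Structure A), Represents L A Q

/-- Every `Q` with `J⁺(D) ⊆ Q ⊆ D` is represented by the principal congruences of some
finite lattice. -/
def FullyFiniteLatticeRepresentable [BoundedOrder D] : Prop :=
  ∀ Q : Set D, JPlus D ⊆ Q →
    ∃ (K : Type v) (_ : Lattice K) (_ : Finite K) (_ : Nonempty K),
      Represents latticeLanguage K Q

variable {D}

/-- A planar Hasse diagram: distinct elements are distinct points of the plane, a larger element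
is placed higher, coverings `a ⋖ b` are drawn as straight line segments, an edge passes
through no vertex but its two ends, and two distinct edges meet only at common ends. -/
structure IsPlanarDiagram (f : D → ℝ × ℝ) : Prop where
  injective : Function.Injective f
  upward : ∀ ⦃a b : D⦄, a < b → (f a).2 < (f b).2
  vertex_edge : ∀ ⦃a b x : D⦄, a ⋖ b → f x ∈ segment ℝ (f a) (f b) → x = a ∨ x = b
  edge_edge : ∀ ⦃a b c d : D⦄, a ⋖ b → c ⋖ d → (a, b) ≠ (c, d) →
    segment ℝ (f a) (f b) ∩ segment ℝ (f c) (f d) ⊆ f '' (({a, b} : Set D) ∩ {c, d})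

variable (D)

/-- A lattice is planar if it is finite and has a planar Hasse diagram. -/
def IsPlanar : Prop := Finite D ∧ ∃ f : D → ℝ × ℝ, IsPlanarDiagram f

variable {D}

/-- `c` is the join of two strictly smaller elements. -/
def JoinReducible (c : D) : Prop := ∃ a b : D, a < c ∧ b < c ∧ a ⊔ b = c

end Lattices

end PrincRep

/-!
Through an isomorphism `Con(A) ≃o D`, the principal congruences `con(a, b)` become a `D`-valued
distance on `A`. Joins of congruences are joins of equivalence relations, so whenever the distance
from `a` to `z` is at most the join of a set `S`, every set that contains `a` but not `z` is left by
a step whose distance is at most a member of `S`.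

Add a single element `m` to `J⁺(D)` and realise `m` as the distance from `a` to `b`.

* If `m` is the join of an antichain of join-irreducible elements, leave `{x | δ(a, x) < m}`: then
  `m` is at most the join of only two members of the antichain, so the antichain has at most two
  members. By Dilworth's theorem the join-irreducible elements form two chains, and counting the
  elements of either chain below `x` places `x` in the grid `ℤ × ℤ`, which becomes a planar diagram
  after a rotation.
* If `m = c ⊓ d` for distinct coatoms, leave `{x | δ(a, x) ≤ m}` by a step to `y` of length at most,
  say, `c`. Then `δ(a, y)` and `δ(b, y)` are join-irreducible and new below `c`, hence equal, since
  `m ⋖ c`. Therefore they lie above `δ(a, b) = m`, which makes `c` itself join-irreducible.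
-/

open FirstOrder.Language.Structure (funMap)

namespace PrincRep

section Congruences

variable {L : FirstOrder.Language.{w, 0}} {A : Type v} [L.Structure A]

theorem con_le_iff {a b : A} {θ : Congr L A} : con L a b ≤ θ ↔ θ.1 a b :=
  ⟨fun h => h fun _ hs => hs.2, fun h _ _ hxy => hxy θ.1 ⟨θ.2, h⟩⟩

theorem isCongruence_iff_le_comap_update {s : Setoid A} :
    IsCongruence L A s ↔ ∀ (n : ℕ) (f : L.Functions n) (x : Fin n → A) (i : Fin n),
      s ≤ s.comap fun c => funMap f (Function.update x i c) := by
  refine ⟨fun hs n f x i c d hcd => hs n f _ _ fun j => ?_, fun hs n f x y hxy => ?_⟩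
  · obtain rfl | hji := eq_or_ne j i
    · simpa only [Function.update_self] using hcd
    · simpa only [Function.update_of_ne hji] using s.refl' (x j)
  · have replace_one (t : Finset (Fin n)) : s (funMap f x) (funMap f (t.piecewise y x)) := by
      induction t using Finset.induction_on with
      | empty => simpa only [Finset.piecewise_empty] using s.refl' (funMap f x)
      | insert i t hi ih =>
        have hstep := hs n f (t.piecewise y x) i (hxy i)
        rw [← Finset.piecewise_eq_of_notMem t y x hi, Setoid.comap_rel,
          Function.update_eq_self, ← Finset.piecewise_insert] at hstep
        exact s.trans' ih hstep
    simpa only [Finset.piecewise_univ] using replace_one Finset.univ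

theorem IsCongruence.sSup {R : Set (Setoid A)} (hR : ∀ r ∈ R, IsCongruence L A r) :
    IsCongruence L A (sSup R) :=
  isCongruence_iff_le_comap_update.2 fun n f x i => sSup_le fun r hr _ _ hcd =>
    le_sSup hr (isCongruence_iff_le_comap_update.1 (hR r hr) n f x i hcd)

end Congruences

theorem exists_rel_mem_notMem_of_sSup {A : Type*} {R : Set (Setoid A)} {P : Set A} {a z : A}
    (haz : sSup R a z) (ha : a ∈ P) (hz : z ∉ P) : ∃ r ∈ R, ∃ x ∈ P, ∃ y ∉ P, r x y := by
  by_contra! hP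
  have hker : sSup R ≤ Setoid.ker (· ∈ P) := sSup_le fun r hr x y hxy =>
    propext ⟨fun hx => by_contra fun hy => hP r hr x hx y hy hxy,
      fun hy => by_contra fun hx => hP r hr y hy x hx (r.symm' hxy)⟩
  have haz_iff : (a ∈ P) = (z ∈ P) := hker haz
  exact hz (haz_iff ▸ ha)

section Distance

variable {L : FirstOrder.Language.{w, 0}} {A : Type v} [L.Structure A] {D : Type u} [Lattice D]
  {φ : Congr L A ≃o D}

/-- The `D`-valued distance on the algebra `A` given by the principal congruences, where
`φ` identifies `Con(A)` with `D`. -/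
def congDist (φ : Congr L A ≃o D) (a b : A) : D := φ (con L a b)

theorem congDist_le_iff {a b : A} {d : D} : congDist φ a b ≤ d ↔ (φ.symm d).1 a b := by
  rw [congDist, ← con_le_iff, OrderIso.le_symm_apply]

theorem congDist_self_le (a : A) (d : D) : congDist φ a a ≤ d :=
  congDist_le_iff.2 (Setoid.refl' _ a)

theorem congDist_comm (a b : A) : congDist φ a b = congDist φ b a :=
  eq_of_forall_ge_iff fun _ => by simp only [congDist_le_iff, Setoid.comm']

theorem congDist_triangle (a b c : A) : congDist φ a c ≤ congDist φ a b ⊔ congDist φ b c :=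
  congDist_le_iff.2 <|
    Setoid.trans' _ (congDist_le_iff.1 le_sup_left) (congDist_le_iff.1 le_sup_right)

theorem exists_congDist_le_of_isLUB {S : Set D} {m : D} (hm : IsLUB S m) {P : Set A} {a z : A}
    (haz : congDist φ a z ≤ m) (ha : a ∈ P) (hz : z ∉ P) :
    ∃ d ∈ S, ∃ x ∈ P, ∃ y ∉ P, congDist φ x y ≤ d := by
  let R : Set (Setoid A) := (fun d => (φ.symm d).1) '' S
  let θ : Congr L A := ⟨sSup R, .sSup (Set.forall_mem_image.2 fun d _ => (φ.symm d).2)⟩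
  have hmθ : m ≤ φ θ := hm.2 fun d hd => by
    rw [← OrderIso.symm_apply_le]
    exact (le_sSup (Set.mem_image_of_mem _ hd) : (φ.symm d).1 ≤ sSup R)
  have hθ : sSup R a z := con_le_iff.1 (φ.le_iff_le.1 (haz.trans hmθ))
  obtain ⟨_, ⟨d, hd, rfl⟩, x, hx, y, hy, hxy⟩ := exists_rel_mem_notMem_of_sSup hθ ha hz
  exact ⟨d, hd, x, hx, y, hy, congDist_le_iff.2 hxy⟩

theorem mem_image_princ_iff {d : D} : d ∈ φ '' Princ L A ↔ ∃ a b, congDist φ a b = d := by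
  constructor
  · rintro ⟨_, ⟨a, b, rfl⟩, rfl⟩
    exact ⟨a, b, rfl⟩
  · rintro ⟨a, b, rfl⟩
    exact ⟨con L a b, ⟨a, b, rfl⟩, rfl⟩

end Distance

section Covers

variable {D : Type u} [Lattice D] {a b i j : D}

theorem sup_eq_of_covBy_of_not_le (hab : a ⋖ b) (hjb : j ≤ b) (hja : ¬j ≤ a) : a ⊔ j = b :=
  (hab.eq_or_eq le_sup_left (sup_le hab.le hjb)).resolve_left fun h => hja (sup_eq_left.1 h)

theorem supPrime_eq_of_covBy (hab : a ⋖ b) (hi : SupPrime i) (hib : i ≤ b) (hia : ¬i ≤ a)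
    (hj : SupPrime j) (hjb : j ≤ b) (hja : ¬j ≤ a) : i = j :=
  le_antisymm
    ((hi.le_sup.1 (hib.trans_eq (sup_eq_of_covBy_of_not_le hab hjb hja).symm)).resolve_left hia)
    ((hj.le_sup.1 (hjb.trans_eq (sup_eq_of_covBy_of_not_le hab hib hia).symm)).resolve_left hja)

end Covers

section Obstructions

variable {D : Type u} [DistribLattice D] {L : FirstOrder.Language.{w, 0}} {A : Type v}
  [L.Structure A]

theorem Represents.card_le_two_of_isAntichain [OrderBot D] {Q : Set D} (h : Represents L A Q)
    {s : Finset D} (hs : IsAntichain (· ≤ ·) (s : Set D)) (hirr : ∀ p ∈ s, SupIrred p)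
    (hm : s.sup id ∈ Q) (hQ : ∀ d ∈ Q, d < s.sup id → d = ⊥ ∨ SupIrred d) : s.card ≤ 2 := by
  classical
  by_contra! hcard
  obtain ⟨φ, rfl⟩ := h
  obtain ⟨a, b, hab⟩ := mem_image_princ_iff.1 hm
  obtain ⟨p₀, hp₀⟩ := Finset.card_pos.1 (zero_lt_two.trans hcard)
  have hle {p : D} (hp : p ∈ s) : p ≤ s.sup id := Finset.le_sup (f := id) hp
  have hpos : ⊥ < s.sup id := (hirr p₀ hp₀).ne_bot.bot_lt.trans_le (hle hp₀)
  obtain ⟨q, hq, x, hax, y, hay, hxy⟩ := exists_congDist_le_of_isLUB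
    (P := {x | congDist φ a x < s.sup id}) Finset.isLUB_sup_id hab.le
    ((congDist_self_le a ⊥).trans_lt hpos) hab.not_lt
  obtain ⟨p, hp, hxp⟩ : ∃ p ∈ s, congDist φ a x ≤ p := by
    rcases hQ _ (mem_image_princ_iff.2 ⟨a, x, rfl⟩) hax with hbot | hx
    · exact ⟨p₀, hp₀, hbot.trans_le bot_le⟩
    · exact hx.supPrime.le_finset_sup.1 hax.le
  have hay' : congDist φ a y ≤ p ⊔ q := (congDist_triangle a x y).trans (sup_le_sup hxp hxy)
  have hsup : s.sup id ≤ p ⊔ q := by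
    have := (hay'.trans (sup_le (hle hp) (hle hq))).eq_of_not_lt hay
    exact this.ge.trans hay'
  obtain ⟨r, hr, hrpq⟩ := Finset.exists_mem_notMem_of_card_lt_card
    ((Finset.card_le_two (a := p) (b := q)).trans_lt hcard)
  simp only [Finset.mem_insert, Finset.mem_singleton, not_or] at hrpq
  rcases (hirr r hr).supPrime.le_sup.1 ((hle hr).trans hsup) with hrp | hrq
  · exact hs hr hp hrpq.1 hrp
  · exact hs hr hq hrpq.2 hrq

theorem supIrred_of_covBy_of_congDist {φ : Congr L A ≃o D} {m c : D} (hmc : m ⋖ c)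
    (hirr : ∀ x y, congDist φ x y ≤ c → congDist φ x y ≤ m ∨ SupIrred (congDist φ x y))
    {a b y : A} (hab : congDist φ a b = m) (hayc : congDist φ a y ≤ c)
    (haym : ¬congDist φ a y ≤ m) : SupIrred c := by
  have hbyc : congDist φ b y ≤ c :=
    (congDist_triangle b a y).trans (sup_le (congDist_comm (φ := φ) b a ▸ hab.trans_le hmc.le) hayc)
  have hbym : ¬congDist φ b y ≤ m := fun h =>
    haym ((congDist_triangle a b y).trans (sup_le hab.le h))
  have hay := (hirr a y hayc).resolve_left haym
  have hby := (hirr b y hbyc).resolve_left hbym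
  have hay_eq_by : congDist φ a y = congDist φ b y :=
    supPrime_eq_of_covBy hmc hay.supPrime hayc haym hby.supPrime hbyc hbym
  have hm_le : m ≤ congDist φ a y := calc
    m = congDist φ a b := hab.symm
    _ ≤ congDist φ a y ⊔ congDist φ y b := congDist_triangle a y b
    _ = congDist φ a y := by rw [congDist_comm y b, ← hay_eq_by, sup_idem]
  rwa [← sup_eq_of_covBy_of_not_le hmc hayc haym, sup_eq_right.2 hm_le]

theorem Represents.supIrred_or_supIrred_of_isCoatom [OrderTop D] {Q : Set D}
    (h : Represents L A Q) {c d : D} (hc : IsCoatom c) (hd : IsCoatom d) (hcd : c ≠ d)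
    (htop : ⊤ ∈ Q) (hm : c ⊓ d ∈ Q) (hQ : ∀ x ∈ Q, x = ⊤ ∨ x ≤ c ⊓ d ∨ SupIrred x) :
    SupIrred c ∨ SupIrred d := by
  obtain ⟨φ, rfl⟩ := h
  obtain ⟨a, b, hab⟩ := mem_image_princ_iff.1 hm
  obtain ⟨s, t, hst⟩ := mem_image_princ_iff.1 htop
  have hsup : c ⊔ d = ⊤ := hc.sup_eq_top_of_ne hd hcd
  have hirr {e : D} (he : IsCoatom e) (x y : A) (hxy : congDist φ x y ≤ e) :
      congDist φ x y ≤ c ⊓ d ∨ SupIrred (congDist φ x y) :=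
    (hQ _ (mem_image_princ_iff.2 ⟨x, y, rfl⟩)).resolve_left (hxy.trans_lt he.lt_top).ne
  obtain ⟨z, haz⟩ : ∃ z, ¬congDist φ a z ≤ c ⊓ d := by
    by_contra! hall
    have htop_le : ⊤ ≤ c ⊓ d := hst ▸ (congDist_triangle s a t).trans
      (sup_le (congDist_comm (φ := φ) s a ▸ hall s) (hall t))
    exact hc.lt_top.not_ge (htop_le.trans inf_le_left)
  obtain ⟨e, he, x, hax, y, hay, hxy⟩ := exists_congDist_le_of_isLUB
    (P := {x | congDist φ a x ≤ c ⊓ d}) (isLUB_pair (a := c) (b := d))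
    (hsup ▸ le_top : congDist φ a z ≤ c ⊔ d) (congDist_self_le a _) haz
  have haye : congDist φ a y ≤ e := (congDist_triangle a x y).trans <|
    sup_le (hax.trans (he.elim (fun h => h ▸ inf_le_left) fun h => h ▸ inf_le_right)) hxy
  rcases he with rfl | rfl
  · exact .inl (supIrred_of_covBy_of_congDist
      (inf_covBy_of_covBy_sup_right (hsup ▸ hd.covBy_top)) (hirr hc) hab haye hay)
  · exact .inr (supIrred_of_covBy_of_congDist
      (inf_covBy_of_covBy_sup_left (hsup ▸ hc.covBy_top)) (hirr hd) hab haye hay)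

end Obstructions

section Dilworth

variable {α : Type*} [PartialOrder α] {s : Finset α} {k : ℕ} {c : α → ℕ}

/-- `t` is an antichain of exactly `n` elements inside `s`; the poset `s` has width less than `n`
when there is none. -/
structure IsNAntichain (s : Finset α) (n : ℕ) (t : Finset α) : Prop where
  subset : t ⊆ s
  isAntichain : IsAntichain (· ≤ ·) (t : Set α)
  card_eq : t.card = n

/-- A partition of `s` into at most `k` chains, encoded by the map that sends an element to the
number of its chain; values outside `s` are irrelevant. -/
structure IsChainColoring (s : Finset α) (k : ℕ) (c : α → ℕ) : Prop where
  lt : ∀ x ∈ s, c x < k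
  le_or_ge : ∀ x ∈ s, ∀ y ∈ s, c x = c y → x ≤ y ∨ y ≤ x

theorem IsChainColoring.exists_mem_eq (hc : IsChainColoring s k c) {t : Finset α}
    (ht : IsNAntichain s k t) {i : ℕ} (hi : i < k) : ∃ x ∈ t, c x = i := by
  have hinj : Set.InjOn c t := fun x hx y hy hxy =>
    (hc.le_or_ge x (ht.subset hx) y (ht.subset hy) hxy).elim (ht.isAntichain.eq hx hy)
      (ht.isAntichain.eq' hx hy)
  have hmaps : Set.MapsTo c t (Finset.range k) := fun x hx =>
    Finset.mem_coe.2 (Finset.mem_range.2 (hc.lt x (ht.subset hx)))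
  exact Finset.surjOn_of_injOn_of_card_le c hmaps hinj (by rw [Finset.card_range, ht.card_eq])
    (Finset.mem_coe.2 (Finset.mem_range.2 hi))

theorem IsChainColoring.exists_greatest (hc : IsChainColoring s k c) {t₀ : Finset α}
    (ht₀ : IsNAntichain s k t₀) {i : ℕ} (hi : i < k) :
    ∃ t, IsNAntichain s k t ∧ ∃ x ∈ t, c x = i ∧
      ∀ t', IsNAntichain s k t' → ∀ y ∈ t', c y = i → y ≤ x := by
  let M : Set α := {x | c x = i ∧ ∃ t, IsNAntichain s k t ∧ x ∈ t}
  have hMs : M ⊆ s := fun _ ⟨_, _, ht, hxt⟩ => ht.subset hxt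
  obtain ⟨x₀, hx₀, hcx₀⟩ := hc.exists_mem_eq ht₀ hi
  obtain ⟨x, hx⟩ := (s.finite_toSet.subset hMs).exists_maximal ⟨x₀, hcx₀, t₀, ht₀, hx₀⟩
  obtain ⟨hcx, t, ht, hxt⟩ := hx.prop
  refine ⟨t, ht, x, hxt, hcx, fun t' ht' y hy hcy => ?_⟩
  exact (hc.le_or_ge y (ht'.subset hy) x (ht.subset hxt) (hcy.trans hcx.symm)).elim id
    (hx.le_of_ge ⟨hcy, t', ht', hy⟩)

theorem IsChainColoring.exists_le_maximal [DecidableEq α] {a : α}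
    (hc : IsChainColoring (s.erase a) k c) (ha : Maximal (· ∈ s) a)
    (hs : ∀ t, ¬IsNAntichain s (k + 1) t) {t₀ : Finset α} (ht₀ : IsNAntichain (s.erase a) k t₀) :
    ∃ x ≤ a, ∃ i < k, ∀ t, IsNAntichain (s.erase a) k t → ∀ y ∈ t, c y = i → y ≤ x := by
  have : Nonempty α := ⟨a⟩
  choose! t ht x hxt hcx hx using fun i (hi : i < k) => hc.exists_greatest ht₀ hi
  suffices ∃ i < k, x i ≤ a by
    obtain ⟨i, hi, hxa⟩ := this
    exact ⟨x i, hxa, i, hi, hx i hi⟩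
  by_contra! hxa
  have hx_eq {i j : ℕ} (hi : i < k) (hj : j < k) (hij : x i ≤ x j) : i = j := by
    obtain ⟨y, hy, hcy⟩ := hc.exists_mem_eq (ht j hj) hi
    have hyx : y = x j := (ht j hj).isAntichain.eq hy (hxt j hj)
      ((hx i hi _ (ht j hj) y hy hcy).trans hij)
    rw [← hcy, hyx, hcx j hj]
  have hxs {i : ℕ} (hi : i < k) : x i ∈ s := Finset.mem_of_mem_erase ((ht i hi).subset (hxt i hi))
  refine hs (insert a ((Finset.range k).image x)) ⟨?_, ?_, ?_⟩
  · simp only [Finset.insert_subset_iff, Finset.image_subset_iff, Finset.mem_range]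
    exact ⟨ha.prop, fun i hi => hxs hi⟩
  · simp only [Finset.coe_insert, Finset.coe_image, Finset.coe_range]
    refine IsAntichain.insert ?_ ?_ ?_
    · rintro _ ⟨i, hi, rfl⟩ _ ⟨j, hj, rfl⟩ hne hij
      exact hne (congrArg x (hx_eq hi hj hij))
    · rintro _ ⟨i, hi, rfl⟩ - hle
      exact hxa i hi hle
    · rintro _ ⟨i, hi, rfl⟩ - hle
      exact hxa i hi (ha.le_of_ge (hxs hi) hle)
  · rw [Finset.card_insert_of_notMem, Finset.card_image_of_injOn, Finset.card_range]
    · exact fun i hi j hj hij => hx_eq (Finset.mem_range.1 hi) (Finset.mem_range.1 hj) hij.le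
    · simp only [Finset.mem_image, Finset.mem_range, not_exists, not_and]
      exact fun i hi hxi => hxa i hi hxi.le

/-- Galvin's induction step for Dilworth's theorem: `K` is formed by `a` and the elements of one
chain up to the greatest one on an antichain of size `k`, so it meets every such antichain. -/
theorem IsChainColoring.exists_chain_sdiff [DecidableEq α] {a : α}
    (hc : IsChainColoring (s.erase a) k c) (ha : Maximal (· ∈ s) a)
    (hs : ∀ t, ¬IsNAntichain s (k + 1) t) :
    ∃ K : Finset α, a ∈ K ∧ IsChain (· ≤ ·) (K : Set α) ∧ ∀ t, ¬IsNAntichain (s \ K) k t := by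
  classical
  by_cases h₀ : ∃ t₀, IsNAntichain (s.erase a) k t₀
  · obtain ⟨t₀, ht₀⟩ := h₀
    obtain ⟨x, hxa, i, hi, hx⟩ := hc.exists_le_maximal ha hs ht₀
    let C : Finset α := {z ∈ s.erase a | c z = i ∧ z ≤ x}
    refine ⟨insert a C, Finset.mem_insert_self a C, ?_, fun t ht => ?_⟩
    · rw [Finset.coe_insert]
      refine IsChain.insert (fun y hy z hz _ => ?_) fun z hz _ => .inr ?_
      · obtain ⟨hys, hcy, -⟩ := Finset.mem_filter.1 hy
        obtain ⟨hzs, hcz, -⟩ := Finset.mem_filter.1 hz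
        exact hc.le_or_ge y hys z hzs (hcy.trans hcz.symm)
      · exact (Finset.mem_filter.1 hz).2.2.trans hxa
    · have hts : t ⊆ s.erase a := ht.subset.trans <| by
        rw [← Finset.sdiff_singleton_eq_erase]
        exact Finset.sdiff_subset_sdiff le_rfl (by simp)
      have ht' : IsNAntichain (s.erase a) k t := ⟨hts, ht.isAntichain, ht.card_eq⟩
      obtain ⟨y, hy, hcy⟩ := hc.exists_mem_eq ht' hi
      have hyC : y ∈ C := Finset.mem_filter.2 ⟨hts hy, hcy, hx t ht' y hy hcy⟩
      exact (Finset.mem_sdiff.1 (ht.subset hy)).2 (Finset.mem_insert_of_mem hyC)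
  · refine ⟨{a}, Finset.mem_singleton_self a, by simp, fun t ht => h₀ ⟨t, ?_⟩⟩
    rwa [Finset.sdiff_singleton_eq_erase] at ht

theorem exists_isChainColoring (s : Finset α) (k : ℕ) (hs : ∀ t, ¬IsNAntichain s (k + 1) t) :
    ∃ c, IsChainColoring s k c := by
  classical
  induction s using Finset.strongInduction generalizing k with
  | H s ih =>
  obtain rfl | hne := s.eq_empty_or_nonempty
  · exact ⟨0, by simp, by simp⟩
  obtain ⟨a, ha⟩ := s.exists_maximal hne
  obtain ⟨c, hc⟩ := ih (s.erase a) (Finset.erase_ssubset ha.prop) k fun t ht =>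
    hs t ⟨ht.subset.trans (Finset.erase_subset a s), ht.isAntichain, ht.card_eq⟩
  obtain ⟨K, haK, hK, hsK⟩ := hc.exists_chain_sdiff ha hs
  obtain _ | k := k
  · exact absurd ⟨by simpa using ha.prop, by simp, Finset.card_singleton a⟩ (hs {a})
  have hsdiff : s \ K ⊂ s :=
    (Finset.ssubset_iff_of_subset Finset.sdiff_subset).2 ⟨a, ha.prop, by simp [haK]⟩
  obtain ⟨c', hc'⟩ := ih (s \ K) hsdiff k hsK
  have hlt {x : α} (hx : x ∈ s) (hxK : x ∉ K) : c' x < k := hc'.lt x (by simp [hx, hxK])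
  refine ⟨fun x => if x ∈ K then k else c' x, fun x hx => ?_, fun x hx y hy hxy => ?_⟩
  · split_ifs with hxK
    · exact k.lt_succ_self
    · exact (hlt hx hxK).trans k.lt_succ_self
  · by_cases hxK : x ∈ K <;> by_cases hyK : y ∈ K <;> simp only [hxK, hyK, if_true, if_false] at hxy
    · exact hK.total hxK hyK
    · exact absurd hxy (hlt hy hyK).ne'
    · exact absurd hxy (hlt hx hxK).ne
    · exact hc'.le_or_ge x (by simp [hx, hxK]) y (by simp [hy, hyK]) hxy

end Dilworth

section Grid

theorem floor_ceil_of_lt_lt {m n : ℤ} {t : ℝ} (hmn : m ≤ n) (hnm : n ≤ m + 1) (h0 : 0 < t)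
    (h1 : t < 1) : ⌊m + t * (n - m)⌋ = m ∧ ⌈m + t * (n - m)⌉ = n := by
  obtain rfl | rfl : n = m ∨ n = m + 1 := by lia
  · simp
  · simp only [Int.cast_add, Int.cast_one, add_sub_cancel_left, mul_one, Int.floor_intCast_add,
      Int.ceil_intCast_add, add_eq_left, add_right_inj, Int.floor_eq_zero_iff, Int.ceil_eq_iff]
    simp [h0, h1, h0.le, h1.le]

/-- The grid point with coordinates `u` in the plane, turned by `π / 4` (and scaled by `√2`) so
that an increase of either coordinate moves the point upwards. -/
def rotate (u : ℤ × ℤ) : ℝ × ℝ := (u.1 - u.2, u.1 + u.2)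

/-- The two coordinates of a point of the plane in the grid of the points `rotate u`, rounded
down. -/
noncomputable def floorCoord (p : ℝ × ℝ) : ℤ × ℤ := (⌊(p.1 + p.2) / 2⌋, ⌊(p.2 - p.1) / 2⌋)

/-- The two coordinates of a point of the plane in the grid of the points `rotate u`, rounded
up. -/
noncomputable def ceilCoord (p : ℝ × ℝ) : ℤ × ℤ := (⌈(p.1 + p.2) / 2⌉, ⌈(p.2 - p.1) / 2⌉)

theorem floorCoord_eq_and_ceilCoord_eq {u v : ℤ × ℤ} (huv : u ≤ v) (hvu : v ≤ u + 1) {t : ℝ}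
    (h0 : 0 < t) (h1 : t < 1) :
    floorCoord (rotate u + t • (rotate v - rotate u)) = u ∧
      ceilCoord (rotate u + t • (rotate v - rotate u)) = v := by
  obtain ⟨hcoord₁, hcoord₂⟩ :
      ((rotate u + t • (rotate v - rotate u)).1 +
        (rotate u + t • (rotate v - rotate u)).2) / 2 = u.1 + t * (v.1 - u.1) ∧
      ((rotate u + t • (rotate v - rotate u)).2 -
        (rotate u + t • (rotate v - rotate u)).1) / 2 = u.2 + t * (v.2 - u.2) := by
    simp only [rotate, Prod.fst_add, Prod.snd_add, Prod.smul_fst, Prod.smul_snd, Prod.fst_sub,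
      Prod.snd_sub, smul_eq_mul]
    constructor <;> ring
  obtain ⟨hfloor₁, hceil₁⟩ := floor_ceil_of_lt_lt huv.1 hvu.1 h0 h1
  obtain ⟨hfloor₂, hceil₂⟩ := floor_ceil_of_lt_lt huv.2 hvu.2 h0 h1
  simp only [floorCoord, ceilCoord, hcoord₁, hcoord₂]
  exact ⟨Prod.ext hfloor₁ hfloor₂, Prod.ext hceil₁ hceil₂⟩

theorem floorCoord_leftInverse : Function.LeftInverse floorCoord rotate := fun u => by
  simpa using (floorCoord_eq_and_ceilCoord_eq le_rfl (le_add_of_nonneg_right zero_le_one)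
    one_half_pos one_half_lt_one (u := u)).1

theorem eq_or_coord_eq_of_mem_segment {u v : ℤ × ℤ} {p : ℝ × ℝ} (huv : u ≤ v) (hvu : v ≤ u + 1)
    (hp : p ∈ segment ℝ (rotate u) (rotate v)) :
    p = rotate u ∨ p = rotate v ∨ floorCoord p = u ∧ ceilCoord p = v := by
  rw [segment_eq_image'] at hp
  obtain ⟨t, ⟨h0, h1⟩, rfl⟩ := hp
  obtain rfl | h0 := h0.eq_or_lt
  · simp
  obtain rfl | h1 := h1.eq_or_lt
  · simp
  · exact .inr (.inr (floorCoord_eq_and_ceilCoord_eq huv hvu h0 h1))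

theorem isPlanarDiagram_of_grid {D : Type*} [Lattice D] {g : D → ℤ × ℤ} (hmono : Monotone g)
    (hinj : Function.Injective g) (hcov : ∀ a b, a ⋖ b → g b ≤ g a + 1) :
    IsPlanarDiagram (rotate ∘ g) := by
  have hfinj : Function.Injective (rotate ∘ g) := floorCoord_leftInverse.injective.comp hinj
  have hends {a b : D} {p : ℝ × ℝ} (hab : a ⋖ b)
      (hp : p ∈ segment ℝ ((rotate ∘ g) a) ((rotate ∘ g) b)) :
      p = (rotate ∘ g) a ∨ p = (rotate ∘ g) b ∨ floorCoord p = g a ∧ ceilCoord p = g b :=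
    eq_or_coord_eq_of_mem_segment (hmono hab.le) (hcov a b hab) hp
  have hvertex {a b x : D} (hab : a ⋖ b)
      (hx : (rotate ∘ g) x ∈ segment ℝ ((rotate ∘ g) a) ((rotate ∘ g) b)) : x = a ∨ x = b := by
    obtain hxa | hxb | ⟨hxa, -⟩ := hends hab hx
    · exact .inl (hfinj hxa)
    · exact .inr (hfinj hxb)
    · exact .inl (hinj ((floorCoord_leftInverse (g x)).symm.trans hxa))
  refine ⟨hfinj, fun a b hab => ?_, fun a b x => hvertex, ?_⟩
  · have hlt : (g a).1 + (g a).2 < (g b).1 + (g b).2 := by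
      obtain ⟨h₁, h₂⟩ | ⟨h₁, h₂⟩ := Prod.lt_iff.1 ((hmono hab.le).lt_of_ne (hinj.ne hab.ne))
      · exact add_lt_add_of_lt_of_le h₁ h₂
      · exact add_lt_add_of_le_of_lt h₁ h₂
    simp only [Function.comp_apply, rotate]
    exact_mod_cast hlt
  · rintro a b c d hab hcd hne p ⟨hp, hp'⟩
    obtain rfl | rfl | ⟨hpa, hpb⟩ := hends hab hp
    · exact ⟨a, ⟨by simp, hvertex hcd hp'⟩, rfl⟩
    · exact ⟨b, ⟨by simp, hvertex hcd hp'⟩, rfl⟩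
    obtain rfl | rfl | ⟨hpc, hpd⟩ := hends hcd hp'
    · exact ⟨c, ⟨hvertex hab hp, by simp⟩, rfl⟩
    · exact ⟨d, ⟨hvertex hab hp, by simp⟩, rfl⟩
    · exact absurd (Prod.ext (hinj (hpa.symm.trans hpc)) (hinj (hpb.symm.trans hpd))) hne

end Grid

section Counting

/-- The number of elements of `C` below `a`, an integer in order to serve as a grid coordinate;
it is `0` by convention if there are infinitely many of them. -/
noncomputable def countBelow {D : Type*} [Preorder D] (C : Set D) (a : D) : ℤ :=
  (C ∩ Set.Iic a).ncard

theorem countBelow_mono {D : Type*} [Preorder D] [Finite D] (C : Set D) :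
    Monotone (countBelow C) := fun _ _ hab =>
  Int.ofNat_le.2 (Set.ncard_le_ncard (Set.inter_subset_inter_right C (Set.Iic_subset_Iic.2 hab)))

theorem inter_Iic_eq_of_countBelow_eq {D : Type*} [Preorder D] [Finite D] {C : Set D}
    (hC : IsChain (· ≤ ·) C) {a b : D} (h : countBelow C a = countBelow C b) :
    C ∩ Set.Iic a = C ∩ Set.Iic b := by
  have hcard : (C ∩ Set.Iic a).ncard = (C ∩ Set.Iic b).ncard := Int.ofNat_inj.1 h
  have htotal : C ∩ Set.Iic a ⊆ C ∩ Set.Iic b ∨ C ∩ Set.Iic b ⊆ C ∩ Set.Iic a := by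
    by_contra! hnot
    obtain ⟨⟨i, hia, hib⟩, j, hjb, hja⟩ := hnot.imp Set.not_subset.1 Set.not_subset.1
    rcases hC.total hia.1 hjb.1 with hij | hji
    · exact hib ⟨hia.1, hij.trans hjb.2⟩
    · exact hja ⟨hjb.1, hji.trans hia.2⟩
  rcases htotal with hsub | hsub
  · exact Set.eq_of_subset_of_ncard_le hsub hcard.ge
  · exact (Set.eq_of_subset_of_ncard_le hsub hcard.le).symm

theorem countBelow_le_add_one_of_covBy {D : Type*} [DistribLattice D] [Finite D] {C : Set D}
    (hC : ∀ j ∈ C, SupIrred j) {a b : D} (hab : a ⋖ b) : countBelow C b ≤ countBelow C a + 1 := by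
  have hnew : ((C ∩ Set.Iic b) \ Set.Iic a).ncard ≤ 1 := (Set.ncard_le_one).2
    fun i ⟨⟨hiC, hib⟩, hia⟩ j ⟨⟨hjC, hjb⟩, hja⟩ =>
      supPrime_eq_of_covBy hab (hC i hiC).supPrime hib hia (hC j hjC).supPrime hjb hja
  have hsub : C ∩ Set.Iic b ⊆ (C ∩ Set.Iic a) ∪ (C ∩ Set.Iic b) \ Set.Iic a := fun j hj =>
    (em (j ≤ a)).imp (fun hja => ⟨hj.1, hja⟩) fun hja => ⟨hj, hja⟩
  have := (Set.ncard_le_ncard hsub).trans (Set.ncard_union_le _ _)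
  unfold countBelow
  lia

end Counting

section Planarity

theorem le_of_forall_supIrred_le {D : Type*} [SemilatticeSup D] [OrderBot D] [WellFoundedLT D]
    {a b : D} (h : ∀ j, SupIrred j → j ≤ a → j ≤ b) : a ≤ b := by
  obtain ⟨s, rfl, hs⟩ := exists_supIrred_decomposition a
  exact Finset.sup_le fun j hj => h j (hs hj) (Finset.le_sup (f := id) hj)

variable {D : Type*} [DistribLattice D] [OrderBot D] [Finite D]

theorem isPlanar_of_supIrred_eq_union {C C' : Set D} (hC : IsChain (· ≤ ·) C)
    (hC' : IsChain (· ≤ ·) C') (h : {j | SupIrred j} = C ∪ C') : IsPlanar D := by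
  let g (a : D) : ℤ × ℤ := (countBelow C a, countBelow C' a)
  have hle {a b : D} (hab : g a = g b) : a ≤ b := le_of_forall_supIrred_le fun j hj hja => by
    obtain ⟨hCab, hCab'⟩ := Prod.mk.inj hab
    rcases h.le hj with hjC | hjC
    · exact ((inter_Iic_eq_of_countBelow_eq hC hCab).le ⟨hjC, hja⟩).2
    · exact ((inter_Iic_eq_of_countBelow_eq hC' hCab').le ⟨hjC, hja⟩).2
  refine ⟨‹_›, rotate ∘ g, isPlanarDiagram_of_grid ?_ ?_ ?_⟩
  · exact (countBelow_mono C).prodMk (countBelow_mono C')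
  · exact fun a b hab => (hle hab).antisymm (hle hab.symm)
  · exact fun a b hab => ⟨countBelow_le_add_one_of_covBy (fun j hj => h.ge (.inl hj)) hab,
      countBelow_le_add_one_of_covBy (fun j hj => h.ge (.inr hj)) hab⟩

theorem isPlanar_of_forall_antichain_card_le_two
    (h : ∀ s : Finset D, IsAntichain (· ≤ ·) (s : Set D) → (∀ p ∈ s, SupIrred p) → s.card ≤ 2) :
    IsPlanar D := by
  let J : Finset D := (Set.toFinite {j : D | SupIrred j}).toFinset
  have hJ {j : D} : j ∈ J ↔ SupIrred j := Set.Finite.mem_toFinset _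
  obtain ⟨c, hc⟩ := exists_isChainColoring J 2 fun t ht => by
    have := h t ht.isAntichain fun p hp => hJ.1 (ht.subset hp)
    rw [ht.card_eq] at this
    lia
  have hchain (i : ℕ) : IsChain (· ≤ ·) {j | SupIrred j ∧ c j = i} := fun x hx y hy _ =>
    hc.le_or_ge x (hJ.2 hx.1) y (hJ.2 hy.1) (hx.2.trans hy.2.symm)
  refine isPlanar_of_supIrred_eq_union (hchain 0) (hchain 1) (Set.ext fun j => ?_)
  refine ⟨fun hj => ?_, fun hj => hj.elim And.left And.left⟩
  have hlt := hc.lt j (hJ.2 hj)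
  exact (by lia : c j = 0 ∨ c j = 1).imp (⟨hj, ·⟩) (⟨hj, ·⟩)

end Planarity

section FullyRepresentable

theorem JoinReducible.not_supIrred {D : Type*} [Lattice D] {c : D} (hc : JoinReducible c) :
    ¬SupIrred c := fun hirr => by
  obtain ⟨a, b, hac, hbc, hab⟩ := hc
  exact (hirr.2 hab).elim hac.ne hbc.ne

variable {D : Type u} [DistribLattice D] [BoundedOrder D]

theorem FullyAlgebraRepresentable.card_le_two_of_isAntichain
    (h : FullyAlgebraRepresentable.{u, v, w} D) {s : Finset D}
    (hs : IsAntichain (· ≤ ·) (s : Set D)) (hirr : ∀ p ∈ s, SupIrred p) : s.card ≤ 2 := by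
  obtain ⟨L, _, A, _, _, hA⟩ := h (insert (s.sup id) (JPlus D)) (Set.subset_insert _ _)
  refine hA.card_le_two_of_isAntichain hs hirr (Set.mem_insert _ _) ?_
  rintro d (rfl | hd | rfl | rfl) hlt
  · exact absurd hlt (lt_irrefl _)
  · exact .inr hd
  · exact .inl rfl
  · exact absurd hlt not_top_lt

theorem FullyAlgebraRepresentable.subsingleton_joinReducible_coatom
    (h : FullyAlgebraRepresentable.{u, v, w} D) :
    {c : D | IsCoatom c ∧ JoinReducible c}.Subsingleton := by
  rintro c ⟨hc, hcred⟩ d ⟨hd, hdred⟩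
  by_contra hcd
  obtain ⟨L, _, A, _, _, hA⟩ := h (insert (c ⊓ d) (JPlus D)) (Set.subset_insert _ _)
  refine (hA.supIrred_or_supIrred_of_isCoatom hc hd hcd ?_ (Set.mem_insert _ _) ?_).elim
    hcred.not_supIrred hdred.not_supIrred
  · exact .inr (.inr (.inr rfl))
  · rintro x (rfl | hx | rfl | rfl)
    · exact .inr (.inl le_rfl)
    · exact .inr (.inr hx)
    · exact .inr (.inl bot_le)
    · exact .inl rfl

end FullyRepresentable

section Transfer

open scoped FirstOrder

universe w'

section Equivalence

variable {L : FirstOrder.Language.{w, 0}} {L' : FirstOrder.Language.{w', 0}} {A : Type v}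
  {B : Type k} [L.Structure A] [L'.Structure B]

/-- A bijection that carries congruences of `A` to congruences of `B`, and conversely, identifies
the congruence lattices, whatever the signatures of `A` and `B` are. -/
def congrOrderIso (e : A ≃ B)
    (he : ∀ s : Setoid B, IsCongruence L A (s.comap e) ↔ IsCongruence L' B s) :
    Congr L' B ≃o Congr L A where
  toFun θ := ⟨θ.1.comap e, (he θ.1).2 θ.2⟩
  invFun θ := ⟨θ.1.comap e.symm, (he _).1 <| by
    have hθ : (θ.1.comap e.symm).comap e = θ.1 := Setoid.ext fun x y => by simp [Setoid.comap_rel]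
    exact hθ.symm ▸ θ.2⟩
  left_inv θ := Subtype.ext (Setoid.ext fun x y => by simp [Setoid.comap_rel])
  right_inv θ := Subtype.ext (Setoid.ext fun x y => by simp [Setoid.comap_rel])
  map_rel_iff' {θ η} := (e.surjective.forall₂ (p := fun x y => θ.1 x y → η.1 x y)).symm

theorem congrOrderIso_con (e : A ≃ B)
    (he : ∀ s : Setoid B, IsCongruence L A (s.comap e) ↔ IsCongruence L' B s) (a b : A) :
    congrOrderIso e he (con L' (e a) (e b)) = con L a b :=
  eq_of_forall_ge_iff fun θ => by
    obtain ⟨θ, rfl⟩ := (congrOrderIso e he).surjective θ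
    rw [OrderIso.le_iff_le, con_le_iff, con_le_iff]
    exact (Setoid.comap_rel e θ.1 a b).symm

theorem Represents.of_equiv {D : Type u} [Lattice D] {Q : Set D} (h : Represents L A Q) (e : A ≃ B)
    (he : ∀ s : Setoid B, IsCongruence L A (s.comap e) ↔ IsCongruence L' B s) :
    Represents L' B Q := by
  obtain ⟨φ, rfl⟩ := h
  refine ⟨(congrOrderIso e he).trans φ, Set.ext fun d => ?_⟩
  simp only [mem_image_princ_iff, congDist, OrderIso.trans_apply, e.surjective.exists,
    congrOrderIso_con]

theorem isCongruence_comap_iff {A : Type*} {B : Type*} [L.Structure A] [L.Structure B]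
    (e : A ≃[L] B) (s : Setoid B) :
    IsCongruence L A (s.comap e) ↔ IsCongruence L B s := by
  refine forall₂_congr fun n f => ?_
  simp only [(e.surjective.comp_left (α := Fin n)).forall, Function.comp_apply, e.map_fun,
    Setoid.comap_rel]

theorem isCongruence_iff_of_isExpansionOn {A : Type*} [L.Structure A] [L'.Structure A]
    (ψ : L →ᴸ L') [ψ.IsExpansionOn A] (hψ : ∀ n, Function.Surjective (ψ.onFunction (n := n)))
    (s : Setoid A) : IsCongruence L A s ↔ IsCongruence L' A s := by
  simp only [IsCongruence, (hψ _).forall, ψ.map_onFunction]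

end Equivalence

/-- The signature `L` with its operation symbols moved to a larger universe. -/
def uliftLanguage (L : FirstOrder.Language.{w', 0}) : FirstOrder.Language.{max w' w, 0} :=
  ⟨fun n => ULift.{w} (L.Functions n), L.Relations⟩

/-- The identification of the symbols of `uliftLanguage L` with those of `L`. -/
def uliftLanguageDown (L : FirstOrder.Language.{w', 0}) : uliftLanguage.{w} L →ᴸ L where
  onFunction := fun {_} f => f.down
  onRelation := fun {_} r => r

theorem FullyFiniteLatticeRepresentable.fullyAlgebraRepresentable {D : Type u} [Lattice D]
    [BoundedOrder D] (h : FullyFiniteLatticeRepresentable.{u, k} D) :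
    FullyAlgebraRepresentable.{u, v, w} D := by
  intro Q hQ
  obtain ⟨K, _, _, _, hK⟩ := h Q hQ
  obtain ⟨A, ⟨e⟩⟩ := Small.equiv_small.{v} (α := K)
  let ψ := uliftLanguageDown.{w} latticeLanguage
  let _ : latticeLanguage.Structure A := e.inducedStructure
  let _ : (uliftLanguage.{w} latticeLanguage).Structure A := ψ.reduct A
  have hA : Represents latticeLanguage A Q :=
    hK.of_equiv e (isCongruence_comap_iff e.inducedStructureEquiv)
  refine ⟨uliftLanguage latticeLanguage, fun _ => inferInstanceAs (IsEmpty Empty), A,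
    e.symm.nonempty, _, hA.of_equiv (Equiv.refl A) fun s => ?_⟩
  exact (isCongruence_iff_of_isExpansionOn ψ (fun n => Equiv.ulift.surjective) s).symm

end Transfer

end PrincRep

theorem theorem1p3 (D : Type u) [DistribLattice D] [BoundedOrder D] [Finite D] :
    (PrincRep.FullyAlgebraRepresentable.{u, v, w} D →
      PrincRep.IsPlanar D ∧ {c : D | IsCoatom c ∧ PrincRep.JoinReducible c}.Subsingleton) ∧
    (PrincRep.FullyFiniteLatticeRepresentable.{u, k} D →
      PrincRep.FullyAlgebraRepresentable.{u, v, w} D) :=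
  ⟨fun h => ⟨PrincRep.isPlanar_of_forall_antichain_card_le_two fun _ hs hirr =>
      h.card_le_two_of_isAntichain hs hirr, h.subsingleton_joinReducible_coatom⟩,
    fun h => h.fullyAlgebraRepresentable⟩
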